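/- Theorem (characterization of minimal non palindrome pairs). All words are finite words over the alphabet $\{0,1\}$. A word is a palindrome pair if it is the concatenation of two (possibly empty) palindromes. A minimal non palindrome pair is a word that is not a palindrome pair but all of whose proper factors (contiguous subwords other than the word itself) are palindrome pairs. A block of a word $w$ is an occurrence in $w$ of a factor $a^n$ ($a$ a letter, $n\ge 1$) that cannot be extended to either side to a longer such occurrence. A block is internal if it is neither the first nor the last block of $w$, and it is maximum if every other block of $w$ has at most its length. Define sets $M_i$ of words for $i\ge 0$ as follows. Let $M_i=\emptyset$ for $i<6$, and let $M_6$ consist of the twelve words $$001011,\ 001101,\ 010011,\ 010110,\ 011001,\ 011010,\ 110100,\ 110010,\ 101100,\ 101001,\ 100110,\ 100101.$$ For $i\ge 7$, the set $M_i$ consists of - every word obtained from a word $w\in M_{i-1}$ by increasing the length of one internal maximum block of $w$ by one; and - if $i$ is even, additionally the four words $$11(01)^{\frac{i-4}{2}}00,\qquad 0\,1^{\frac{i-4}{2}}\,0\,1^{\frac{i-4}{2}+1}\,0,\qquad 1\,0^{\frac{i-4}{2}}\,1\,0^{\frac{i-4}{2}+1}\,1,\qquad 0\,1^{\frac{i-2}{2}}\,0^{\frac{i-2}{2}}\,1$$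 and their reverses. Then for every $i\ge 0$, the set of minimal non palindrome pairs of length $i$ over $\{0,1\}$ is exactly $M_i$. In particular, the binary minimal non palindrome pairs are exactly the words in $\bigcup_{i\ge 6} M_i$. -/

import Mathlib

namespace PalindromePairs

/-- A word is a palindrome pair if it is a product of two (possibly empty) palindromes. -/
def IsPalindromePair {α : Type*} (w : List α) : Prop :=
  ∃ p q : List α, w = p ++ q ∧ p.Palindrome ∧ q.Palindrome

/-- A minimal non palindrome pair: not a palindrome pair, but every proper factor
(contiguous subword different from the whole word) is a palindrome pair. -/
def IsMinimalNonPalindromePair {α : Type*} (w : List α) : Prop :=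
  ¬ IsPalindromePair w ∧ ∀ u : List α, u <:+: w → u ≠ w → IsPalindromePair u

/-- The occurrence of `a ^ n` between `x` and `y` in `w = x a ^ n y` is a block of `w`:
a nonempty run of one letter that cannot be extended to either side. -/
def IsBlock {α : Type*} (w x : List α) (a : α) (n : ℕ) (y : List α) : Prop :=
  w = x ++ List.replicate n a ++ y ∧ 1 ≤ n ∧ x.getLast? ≠ some a ∧ y.head? ≠ some a

/-- A block that is neither the first nor the last block of `w` and is at least as long as
every other block of `w`. -/
def IsInternalMaximumBlock {α : Type*} (w x : List α) (a : α) (n : ℕ) (y : List α) : Prop :=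
  IsBlock w x a n y ∧ x ≠ [] ∧ y ≠ [] ∧
    ∀ (x' : List α) (b : α) (m : ℕ) (y' : List α), IsBlock w x' b m y' → m ≤ n

/-- `w'` is obtained from `w` by extending one internal maximum block of `w` by one letter. -/
def ExtendsInternalMaximumBlock {α : Type*} (w w' : List α) : Prop :=
  ∃ (x : List α) (a : α) (n : ℕ) (y : List α),
    IsInternalMaximumBlock w x a n y ∧ w' = x ++ List.replicate (n + 1) a ++ y

/-- The twelve words of length six from which the construction starts. -/
def lengthSixWords : List (List (Fin 2)) :=
  [[0, 0, 1, 0, 1, 1], [0, 0, 1, 1, 0, 1], [0, 1, 0, 0, 1, 1],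
   [0, 1, 0, 1, 1, 0], [0, 1, 1, 0, 0, 1], [0, 1, 1, 0, 1, 0],
   [1, 1, 0, 1, 0, 0], [1, 1, 0, 0, 1, 0], [1, 0, 1, 1, 0, 0],
   [1, 0, 1, 0, 0, 1], [1, 0, 0, 1, 1, 0], [1, 0, 0, 1, 0, 1]]

/-- The words `11(01)^((i-4)/2)00`, `0 1^((i-4)/2) 0 1^((i-4)/2+1) 0`,
`1 0^((i-4)/2) 1 0^((i-4)/2+1) 1` and `0 1^((i-2)/2) 0^((i-2)/2) 1`.
Only used for even `i ≥ 8`. -/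
def addedWords (i : ℕ) : List (List (Fin 2)) :=
  [[1, 1] ++ (List.replicate ((i - 4) / 2) [0, 1]).flatten ++ [0, 0],
   [0] ++ List.replicate ((i - 4) / 2) 1 ++ [0] ++ List.replicate ((i - 4) / 2 + 1) 1 ++ [0],
   [1] ++ List.replicate ((i - 4) / 2) 0 ++ [1] ++ List.replicate ((i - 4) / 2 + 1) 0 ++ [1],
   [0] ++ List.replicate ((i - 2) / 2) 1 ++ List.replicate ((i - 2) / 2) 0 ++ [1]]

/-- `Constructed i w`: the word `w` is produced at stage `i` of the inductive construction. -/
inductive Constructed : ℕ → List (Fin 2) → Prop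
  | base (w : List (Fin 2)) : w ∈ lengthSixWords → Constructed 6 w
  | extend (i : ℕ) (w w' : List (Fin 2)) : 7 ≤ i → Constructed (i - 1) w →
      ExtendsInternalMaximumBlock w w' → Constructed i w'
  | add (i : ℕ) (w : List (Fin 2)) : 7 ≤ i → Even i → w ∈ addedWords i → Constructed i w
  | addReverse (i : ℕ) (w : List (Fin 2)) : 7 ≤ i → Even i → w ∈ addedWords i →
      Constructed i w.reverse

end PalindromePairs

namespace PalindromePairs

/-! Two explicit families of words carry the proof. A tame word `a^p (b a^x)^k b a^q` is a
palindrome pair: `(b a^x)^k b` is a palindrome, so removing the surplus of `a`s from the longer end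
leaves a palindrome, and the surplus is itself one. Since `p` and `q` are independent of `x`,
tameness passes to factors.

A critical word is not a palindrome pair, but it becomes tame once its first or last letter is
deleted, so it is minimal (`Critical.isMinimalNonPalindromePair`). Conversely, over two letters
every word that is not tame has a critical factor (`tame_or_exists_critical_infix`); a minimal non
palindrome pair is not tame, hence equals that factor. So minimal non palindrome pairs and critical
words coincide.

It remains to match critical words with the construction. Lengthening an internal maximum block
keeps a word critical (`Critical.extends`). In the other direction, each critical word shrinks along
its longest internal block until it reaches a word of length six or one of the added words, which
are those where no such shrinking is available (`Critical.constructed`). -/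

variable {α : Type*}

/-- The word `a^n₁ b^n₂ a^n₃ b^n₄`. -/
def run4 (a b : α) (n₁ n₂ n₃ n₄ : ℕ) : List α :=
  List.replicate n₁ a ++ (List.replicate n₂ b ++ (List.replicate n₃ a ++ List.replicate n₄ b))

/-- The word `a^n₁ b^n₂ a^n₃ b^n₄ a^n₅`. -/
def run5 (a b : α) (n₁ n₂ n₃ n₄ n₅ : ℕ) : List α :=
  List.replicate n₁ a ++ (List.replicate n₂ b ++ (List.replicate n₃ a ++
    (List.replicate n₄ b ++ List.replicate n₅ a)))

/-- The word `bb(ab)^k aa`. -/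
def zigzag (a b : α) (k : ℕ) : List α :=
  [b, b] ++ (List.replicate k [a, b]).flatten ++ [a, a]

/-- The words that turn out to be the binary minimal non palindrome pairs. -/
inductive Critical : List α → Prop
  | doubled (a b : α) (n : ℕ) : a ≠ b → 2 ≤ n → Critical (run4 a b 2 n 1 1)
  | doubledReverse (a b : α) (n : ℕ) : a ≠ b → 2 ≤ n → Critical (run4 a b 1 1 n 2)
  | adjacent (a b : α) (p q : ℕ) : a ≠ b → 2 ≤ p → 2 ≤ q → Critical (run4 a b 1 p q 1)
  | unequal (a b : α) (p q : ℕ) : a ≠ b → 1 ≤ p → 1 ≤ q → p ≠ q → Critical (run5 a b 1 p 1 q 1)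
  | zigzag (a b : α) (k : ℕ) : a ≠ b → 1 ≤ k → Critical (zigzag a b k)

theorem run4_length (a b : α) (n₁ n₂ n₃ n₄ : ℕ) :
    (run4 a b n₁ n₂ n₃ n₄).length = n₁ + n₂ + n₃ + n₄ := by
  simp [run4]; omega

theorem run5_length (a b : α) (n₁ n₂ n₃ n₄ n₅ : ℕ) :
    (run5 a b n₁ n₂ n₃ n₄ n₅).length = n₁ + n₂ + n₃ + n₄ + n₅ := by
  simp [run5]; omega

theorem zigzag_length (a b : α) (k : ℕ) : (zigzag a b k).length = 2 * k + 4 := by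
  simp [zigzag]; omega

theorem run4_reverse (a b : α) (n₁ n₂ n₃ n₄ : ℕ) :
    (run4 a b n₁ n₂ n₃ n₄).reverse = run4 b a n₄ n₃ n₂ n₁ := by
  simp [run4]

theorem run5_reverse (a b : α) (n₁ n₂ n₃ n₄ n₅ : ℕ) :
    (run5 a b n₁ n₂ n₃ n₄ n₅).reverse = run5 a b n₅ n₄ n₃ n₂ n₁ := by
  simp [run5]

/-- The conjugation identity that regroups periodic words; it gives both the symmetry of `(b a^x)^k
b` and the tame form of truncated zigzags. -/
theorem flatten_replicate_append_comm (u v : List α) (k : ℕ) :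
    (List.replicate k (u ++ v)).flatten ++ u = u ++ (List.replicate k (v ++ u)).flatten := by
  induction k with
  | zero => simp
  | succ k ih => simp [List.replicate_succ, ih]

theorem zigzag_reverse (a b : α) (k : ℕ) : (zigzag a b k).reverse = zigzag b a k := by
  simp [zigzag, List.reverse_flatten]

theorem Critical.reverse {w : List α} (h : Critical w) : Critical w.reverse := by
  cases h with
  | doubled a b n hab hn => rw [run4_reverse]; exact .doubledReverse b a n hab.symm hn
  | doubledReverse a b n hab hn => rw [run4_reverse]; exact .doubled b a n hab.symm hn
  | adjacent a b p q hab hp hq => rw [run4_reverse]; exact .adjacent b a q p hab.symm hq hp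
  | unequal a b p q hab hp hq h => rw [run5_reverse]; exact .unequal a b q p hab hq hp h.symm
  | zigzag a b k hab hk => rw [zigzag_reverse]; exact .zigzag b a k hab.symm hk

/-! ### Critical words are not palindrome pairs -/

/-- Here `m` is the cut between the two palindromes. Phrasing the symmetries by positions reduces
non-existence of a cut to linear arithmetic. -/
theorem IsPalindromePair.exists_reflection {w : List α} (h : IsPalindromePair w) :
    ∃ m ≤ w.length, (∀ i j, i + j + 1 = m → w[i]? = w[j]?) ∧
      ∀ i j, i + j + 1 = m + w.length → m ≤ i → m ≤ j → w[i]? = w[j]? := by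
  obtain ⟨p, q, rfl, hp, hq⟩ := h
  have key : ∀ u : List α, u.Palindrome → ∀ i j, i + j + 1 = u.length → u[i]? = u[j]? := by
    intro u hu i j hij
    conv_lhs => rw [← hu.reverse_eq]
    rw [List.getElem?_reverse (by omega)]
    congr 1; omega
  refine ⟨p.length, by simp, fun i j hij => ?_, fun i j hij hi hj => ?_⟩
  · rw [List.getElem?_append_left (by omega), List.getElem?_append_left (by omega)]
    exact key p hp i j hij
  · rw [List.getElem?_append_right hi, List.getElem?_append_right hj]
    rw [List.length_append] at hij
    exact key q hq _ _ (by omega)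

theorem IsPalindromePair.reverse {w : List α} (h : IsPalindromePair w) :
    IsPalindromePair w.reverse := by
  obtain ⟨p, q, rfl, hp, hq⟩ := h
  exact ⟨q, p, by simp [hp.reverse_eq, hq.reverse_eq], hq, hp⟩

/-- A reflection of the positions of a word whose letters are described by a predicate. -/
theorem IsPalindromePair.exists_reflection_of_getElem? {w : List α} (h : IsPalindromePair w)
    {a b : α} (hab : a ≠ b) (n : ℕ) (hn : w.length = n) (P : ℕ → Prop) [DecidablePred P]
    (hP : ∀ i < n, w[i]? = some (if P i then a else b)) :
    ∃ m ≤ n, (∀ i j, i + j + 1 = m → (P i ↔ P j)) ∧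
      ∀ i j, i + j + 1 = m + n → m ≤ i → m ≤ j → (P i ↔ P j) := by
  subst hn
  have key : ∀ i j, i < w.length → j < w.length → w[i]? = w[j]? → (P i ↔ P j) := by
    intro i j hi hj hij
    rw [hP i hi, hP j hj, Option.some_inj] at hij
    by_cases h1 : P i <;> by_cases h2 : P j <;> simp_all [eq_comm]
  obtain ⟨m, hm, h1, h2⟩ := h.exists_reflection
  exact ⟨m, hm, fun i j hij => key i j (by omega) (by omega) (h1 i j hij),
    fun i j hij hi hj => key i j (by omega) (by omega) (h2 i j hij hi hj)⟩

theorem run4_getElem? (a b : α) (n₁ n₂ n₃ n₄ i : ℕ) (hi : i < n₁ + n₂ + n₃ + n₄) :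
    (run4 a b n₁ n₂ n₃ n₄)[i]? =
      some (if i < n₁ ∨ n₁ + n₂ ≤ i ∧ i < n₁ + n₂ + n₃ then a else b) := by
  simp only [run4, List.getElem?_append, List.getElem?_replicate, List.length_replicate]
  split_ifs <;> first | rfl | omega

theorem run5_getElem? (a b : α) (n₁ n₂ n₃ n₄ n₅ i : ℕ) (hi : i < n₁ + n₂ + n₃ + n₄ + n₅) :
    (run5 a b n₁ n₂ n₃ n₄ n₅)[i]? =
      some (if i < n₁ ∨ n₁ + n₂ ≤ i ∧ i < n₁ + n₂ + n₃ ∨ n₁ + n₂ + n₃ + n₄ ≤ i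
        then a else b) := by
  simp only [run5, List.getElem?_append, List.getElem?_replicate, List.length_replicate]
  split_ifs <;> first | rfl | omega

theorem flatten_replicate_pair_getElem? (a b : α) (k i : ℕ) (hi : i < 2 * k) :
    (List.replicate k [a, b]).flatten[i]? = some (if i % 2 = 0 then a else b) := by
  induction k generalizing i with
  | zero => omega
  | succ k ih =>
    rw [List.replicate_succ, List.flatten_cons]
    rcases i with _ | _ | i
    · simp
    · simp
    · simpa [show (i + 1 + 1) % 2 = i % 2 by omega] using ih i (by omega)

theorem zigzag_getElem? (a b : α) (k i : ℕ) (hi : i < 2 * k + 4) :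
    (zigzag a b k)[i]? =
      some (if i ≠ 0 ∧ i % 2 = 0 ∨ 2 * k + 2 ≤ i then a else b) := by
  have hlen : (List.replicate k [a, b]).flatten.length = 2 * k := by simp; omega
  rcases i with _ | _ | i
  · simp [zigzag]
  · simp [zigzag]
  · simp only [zigzag, List.cons_append, List.nil_append, List.getElem?_cons_succ]
    rcases lt_or_ge i (2 * k) with h | h
    · rw [List.getElem?_append_left (by omega), flatten_replicate_pair_getElem? a b k i h]
      congr 2
      simp only [eq_iff_iff]; omega
    · rw [List.getElem?_append_right (by omega), if_pos (by omega), hlen]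
      obtain h | h : i - 2 * k = 0 ∨ i - 2 * k = 1 := by omega
      all_goals simp [h]

theorem not_isPalindromePair_run4_doubled {a b : α} (hab : a ≠ b) {n : ℕ} (hn : 2 ≤ n) :
    ¬ IsPalindromePair (run4 a b 2 n 1 1) := by
  intro h
  obtain ⟨m, hm, h1, h2⟩ := h.exists_reflection_of_getElem? hab _ (run4_length ..) _
    (run4_getElem? a b 2 n 1 1)
  -- The two outermost mirror pairs of each palindrome exclude every cut. If the palindrome is too
  -- short for a pair, the premises of that instance fail and it is vacuous.
  have e1 := h1 0 (m - 1)
  have e2 := h1 1 (m - 2)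
  have e3 := h2 m (n + 3)
  have e4 := h2 (m + 1) (n + 2)
  omega

theorem not_isPalindromePair_run4_adjacent {a b : α} (hab : a ≠ b) {p q : ℕ} (hp : 2 ≤ p)
    (hq : 2 ≤ q) : ¬ IsPalindromePair (run4 a b 1 p q 1) := by
  intro h
  obtain ⟨m, hm, h1, h2⟩ := h.exists_reflection_of_getElem? hab _ (run4_length ..) _
    (run4_getElem? a b 1 p q 1)
  have e1 := h1 0 (m - 1)
  have e2 := h1 1 (m - 2)
  have e3 := h2 m (p + q + 1)
  have e4 := h2 (m + 1) (p + q)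
  omega

theorem not_isPalindromePair_run5 {a b : α} (hab : a ≠ b) {p q : ℕ} (hp : 1 ≤ p)
    (hq : 1 ≤ q) (hpq : p ≠ q) : ¬ IsPalindromePair (run5 a b 1 p 1 q 1) := by
  intro h
  obtain ⟨m, hm, h1, h2⟩ := h.exists_reflection_of_getElem? hab _ (run5_length ..) _
    (run5_getElem? a b 1 p 1 q 1)
  have e1 := h1 0 (m - 1)
  -- Position `p + 1` holds the middle `a`. Its mirror image excludes the cuts `m = 0` and `m = p +
  -- q + 3`, where the whole word would be a palindrome although `p ≠ q`.
  have e2 := h1 (p + 1) (m - (p + 2))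
  have e3 := h2 m (p + q + 2)
  have e4 := h2 (p + 1) (m + q + 1)
  omega

theorem not_isPalindromePair_zigzag {a b : α} (hab : a ≠ b) {k : ℕ} (hk : 1 ≤ k) :
    ¬ IsPalindromePair (zigzag a b k) := by
  intro h
  obtain ⟨m, hm, h1, h2⟩ := h.exists_reflection_of_getElem? hab _ (zigzag_length ..) _
    (zigzag_getElem? a b k)
  have e1 := h1 0 (m - 1)
  have e2 := h1 1 (m - 2)
  have e3 := h2 m (2 * k + 3)
  have e4 := h2 (m + 1) (2 * k + 2)
  omega

theorem Critical.not_isPalindromePair {w : List α} (h : Critical w) : ¬ IsPalindromePair w := by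
  cases h with
  | doubled a b n hab hn => exact not_isPalindromePair_run4_doubled hab hn
  | doubledReverse a b n hab hn =>
    intro h
    have := h.reverse
    rw [run4_reverse] at this
    exact not_isPalindromePair_run4_doubled hab.symm hn this
  | adjacent a b p q hab hp hq => exact not_isPalindromePair_run4_adjacent hab hp hq
  | unequal a b p q hab hp hq h => exact not_isPalindromePair_run5 hab hp hq h
  | zigzag a b k hab hk => exact not_isPalindromePair_zigzag hab hk

/-! ### Tame words -/

/-- The word `a^p (b a^x)^k b a^q`. -/
def tameWord (a b : α) (p x k q : ℕ) : List α :=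
  List.replicate p a ++ ((List.replicate k (b :: List.replicate x a)).flatten ++
    b :: List.replicate q a)

/-- A word is tame if it is empty or of the form `a^p (b a^x)^k b a^q` with `a ≠ b`. -/
def Tame (w : List α) : Prop :=
  w = [] ∨ ∃ (a b : α) (p x k q : ℕ), a ≠ b ∧ w = tameWord a b p x k q

theorem flatten_replicate_cons_append_reverse (a b : α) (x k : ℕ) :
    ((List.replicate k (b :: List.replicate x a)).flatten ++ [b]).reverse =
      (List.replicate k (b :: List.replicate x a)).flatten ++ [b] := by
  have := flatten_replicate_append_comm [b] (List.replicate x a) k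
  simp only [List.cons_append, List.nil_append] at this
  simp [List.reverse_flatten, this]

theorem tameWord_eq (a b : α) (p x k q : ℕ) :
    tameWord a b p x k q = List.replicate p a ++
      (((List.replicate k (b :: List.replicate x a)).flatten ++ [b]) ++ List.replicate q a) := by
  simp [tameWord]

theorem tameWord_reverse (a b : α) (p x k q : ℕ) :
    (tameWord a b p x k q).reverse = tameWord a b q x k p := by
  rw [tameWord_eq, tameWord_eq, List.reverse_append, List.reverse_append,
    flatten_replicate_cons_append_reverse]
  simp

theorem Tame.reverse {w : List α} (h : Tame w) : Tame w.reverse := by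
  rcases h with rfl | ⟨a, b, p, x, k, q, hab, rfl⟩
  · exact .inl rfl
  · exact .inr ⟨a, b, q, x, k, p, hab, tameWord_reverse ..⟩

theorem isPalindromePair_tameWord_add (a b : α) (p x k q : ℕ) :
    IsPalindromePair (tameWord a b (p + q) x k q) := by
  refine ⟨List.replicate p a, tameWord a b q x k q, ?_, ?_, ?_⟩
  · simp [tameWord, List.replicate_add p q, -List.replicate_append_replicate]
  · exact .of_reverse_eq (by simp)
  · exact .of_reverse_eq (tameWord_reverse ..)

theorem Tame.isPalindromePair {w : List α} (h : Tame w) : IsPalindromePair w := by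
  rcases h with rfl | ⟨a, b, p, x, k, q, hab, rfl⟩
  · exact ⟨[], [], rfl, .nil, .nil⟩
  · rcases le_total q p with hpq | hpq
    · obtain ⟨d, rfl⟩ := Nat.exists_eq_add_of_le' hpq
      exact isPalindromePair_tameWord_add ..
    · obtain ⟨d, rfl⟩ := Nat.exists_eq_add_of_le' hpq
      rw [← List.reverse_reverse (tameWord _ _ _ _ _ _), tameWord_reverse]
      exact (isPalindromePair_tameWord_add ..).reverse

theorem tame_replicate {a b : α} (hab : a ≠ b) (n : ℕ) : Tame (List.replicate n a) := by
  cases n with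
  | zero => exact .inl rfl
  | succ n =>
    -- The letters swap roles: with `x = 0` the central part is a pure power of `a`.
    refine .inr ⟨b, a, 0, 0, n, 0, hab.symm, ?_⟩
    simp [tameWord, List.replicate_succ']

/-- If `p = 0`, the deleted letter is a `b`, and the `a^x` behind it becomes the new initial run;
with no period left, only a power of `a` remains. -/
theorem Tame.of_cons {c : α} {w : List α} (h : Tame (c :: w)) : Tame w := by
  rcases h with h | ⟨a, b, p, x, k, q, hab, h⟩
  · simp at h
  · cases p with
    | succ p =>
      refine .inr ⟨a, b, p, x, k, q, hab, ?_⟩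
      simp only [tameWord, List.replicate_succ, List.cons_append, List.cons.injEq] at h
      exact h.2
    | zero =>
      cases k with
      | zero =>
        simp only [tameWord, List.replicate_zero, List.flatten_nil, List.nil_append,
          List.cons.injEq] at h
        rw [h.2]; exact tame_replicate hab q
      | succ k =>
        refine .inr ⟨a, b, x, x, k, q, hab, ?_⟩
        simpa [tameWord, List.replicate_succ] using (List.cons.inj h).2

theorem Tame.of_append_right {s w : List α} (h : Tame (s ++ w)) : Tame w := by
  induction s with
  | nil => exact h
  | cons c s ih => exact ih h.of_cons

theorem Tame.of_append_left {w t : List α} (h : Tame (w ++ t)) : Tame w := by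
  have := h.reverse
  rw [List.reverse_append] at this
  simpa using this.of_append_right.reverse

theorem Tame.of_infix {u w : List α} (h : Tame w) (hu : u <:+: w) : Tame u := by
  obtain ⟨s, t, rfl⟩ := hu
  exact h.of_append_left.of_append_right

/-! ### Critical words are minimal non palindrome pairs -/

/-- A proper factor misses the first or the last letter. -/
theorem tame_of_infix_of_ne {u w : List α} (htail : Tame w.tail) (hrev : Tame w.reverse.tail)
    (hu : u <:+: w) (hne : u ≠ w) : Tame u := by
  obtain ⟨s, t, rfl⟩ := hu
  rcases s with _ | ⟨c, s⟩
  · rcases t.eq_nil_or_concat with rfl | ⟨t, c, rfl⟩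
    · simp at hne
    · have := hrev.reverse
      simp at this
      exact this.of_append_left
  · exact htail.of_infix ⟨s, t, by simp⟩

theorem tame_tail_run4_doubled {a b : α} (hab : a ≠ b) (n : ℕ) :
    Tame (run4 a b 2 n 1 1).tail :=
  .inr ⟨b, a, 0, n, 1, 1, hab.symm, by simp [run4, tameWord, List.replicate_succ]⟩

theorem tame_tail_run4_doubledReverse {a b : α} (hab : a ≠ b) {n : ℕ} (hn : 1 ≤ n) :
    Tame (run4 a b 1 1 n 2).tail := by
  obtain ⟨n, rfl⟩ := Nat.exists_eq_add_of_le' hn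
  exact .inr ⟨b, a, 1, 0, n, 2, hab.symm, by simp [run4, tameWord, List.replicate_succ']⟩

theorem tame_tail_run4_adjacent {a b : α} (hab : a ≠ b) (p : ℕ) {q : ℕ} (hq : 1 ≤ q) :
    Tame (run4 a b 1 p q 1).tail := by
  obtain ⟨q, rfl⟩ := Nat.exists_eq_add_of_le' hq
  exact .inr ⟨b, a, p, 0, q, 1, hab.symm, by simp [run4, tameWord, List.replicate_succ']⟩

theorem tame_tail_run5 {a b : α} (hab : a ≠ b) (p q : ℕ) : Tame (run5 a b 1 p 1 q 1).tail :=
  .inr ⟨b, a, p, q, 1, 0, hab.symm, by simp [run5, tameWord]⟩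

theorem tame_tail_zigzag {a b : α} (hab : a ≠ b) (k : ℕ) : Tame (zigzag a b k).tail := by
  refine .inr ⟨a, b, 0, 1, k, 2, hab, ?_⟩
  have := flatten_replicate_append_comm [b] [a] k
  simp only [List.cons_append, List.nil_append] at this
  rw [tameWord_eq, show List.replicate 1 a = [a] from rfl, this]
  rfl

theorem Critical.tame_tail {w : List α} (h : Critical w) : Tame w.tail := by
  cases h with
  | doubled a b n hab hn => exact tame_tail_run4_doubled hab n
  | doubledReverse a b n hab hn => exact tame_tail_run4_doubledReverse hab (by omega)
  | adjacent a b p q hab hp hq => exact tame_tail_run4_adjacent hab p (by omega)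
  | unequal a b p q hab hp hq h => exact tame_tail_run5 hab p q
  | zigzag a b k hab hk => exact tame_tail_zigzag hab k

theorem Critical.isMinimalNonPalindromePair {w : List α} (h : Critical w) :
    IsMinimalNonPalindromePair w :=
  ⟨h.not_isPalindromePair, fun _ hu hne =>
    (tame_of_infix_of_ne h.tame_tail h.reverse.tame_tail hu hne).isPalindromePair⟩

/-! ### Words that are not tame have a critical factor -/

/-- The new `b` closes off the run `a^p`, which is harmless if `k = 0` or `p = x`. Otherwise a
critical word, if any, occurs as a prefix: for `x = 0` it is of type `doubledReverse` or `adjacent`;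
for `p = 0` it is a zigzag (`x = 1`) or `doubled` (`x ≥ 2`); for `p, x ≥ 1` it is `b a^p b a^x b`.
The tame exceptions have a short final run `a^q`. -/
theorem tame_or_exists_critical_infix_cons_tameWord {a b : α} (hab : a ≠ b) (p x k q : ℕ) :
    Tame (b :: tameWord a b p x k q) ∨ ∃ f, Critical f ∧ f <:+: b :: tameWord a b p x k q := by
  rcases k with _ | k
  · exact .inl (.inr ⟨a, b, 0, p, 1, q, hab, by simp [tameWord]⟩)
  by_cases hpx : p = x
  · subst hpx
    exact .inl (.inr ⟨a, b, 0, p, k + 2, q, hab, by simp [tameWord, List.replicate_succ]⟩)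
  rcases x with _ | x
  · have hw : b :: tameWord a b p 0 (k + 1) q = run4 b a 1 p (k + 2) q := by
      simp [tameWord, run4, List.replicate_succ']
    rw [hw]
    rcases q with _ | q
    · obtain ⟨p, rfl⟩ := Nat.exists_eq_succ_of_ne_zero hpx
      exact .inl (.inr ⟨b, a, 1, 0, p, k + 2, hab.symm, by
        simp [tameWord, run4, List.replicate_succ']⟩)
    obtain rfl | hp : p = 1 ∨ 2 ≤ p := by omega
    · rcases q with _ | q
      · exact .inl (.inr ⟨b, a, 1, k + 2, 1, 0, hab.symm, by simp [tameWord, run4]⟩)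
      · refine .inr ⟨_, .doubledReverse b a (k + 2) hab.symm (by omega), [],
          List.replicate q a, ?_⟩
        simp [run4, show q + 1 + 1 = 2 + q by omega, List.replicate_add]
    · refine .inr ⟨_, .adjacent b a p (k + 2) hab.symm hp (by omega), [],
          List.replicate q a, ?_⟩
      simp [run4, show q + 1 = 1 + q by omega, List.replicate_add]
  rcases p with _ | p
  · rcases x with _ | x
    · have hw : b :: tameWord a b 0 1 (k + 1) q =
          b :: b :: ((List.replicate (k + 1) [a, b]).flatten ++ List.replicate q a) := by
        have := flatten_replicate_append_comm [b] [a] (k + 1)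
        simp only [List.cons_append, List.nil_append] at this
        rw [← List.cons_append, ← this]
        simp [tameWord]
      rw [hw]
      rcases q with _ | _ | q
      · refine .inl (.inr ⟨b, a, 2, 1, k, 1, hab.symm, ?_⟩)
        simp [tameWord, List.replicate_succ']
      · exact .inl (.inr ⟨b, a, 2, 1, k + 1, 0, hab.symm, by
          simp [tameWord, List.replicate_succ (n := 1)]⟩)
      · refine .inr ⟨_, .zigzag a b (k + 1) hab (by omega), [], List.replicate q a, ?_⟩
        simp [PalindromePairs.zigzag, List.replicate_succ (n := q),
          List.replicate_succ (n := q + 1)]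
    · have hw : b :: tameWord a b 0 (x + 2) (k + 1) q =
          b :: b :: (List.replicate (x + 2) a ++ tameWord a b 0 (x + 2) k q) := by
        simp [tameWord, List.replicate_succ (n := k)]
      rw [hw]
      have hc := Critical.doubled b a (x + 2) hab.symm (by omega)
      rcases k with _ | k
      · rcases q with _ | q
        · exact .inl (.inr ⟨b, a, 2, 0, x + 1, 1, hab.symm, by
            simp [tameWord, List.replicate_succ' (n := x + 1), List.replicate_succ (n := 1)]⟩)
        · refine .inr ⟨_, hc, [], List.replicate q a, ?_⟩
          simp [run4, tameWord, List.replicate_succ (n := q), List.replicate_succ (n := 1)]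
      · refine .inr ⟨_, hc, [], List.replicate (x + 1) a ++ tameWord a b 0 (x + 2) k q, ?_⟩
        simp [run4, tameWord, List.replicate_succ (n := x + 1), List.replicate_succ (n := k),
          List.replicate_succ (n := 1)]
  · refine .inr ⟨_, .unequal b a (p + 1) (x + 1) hab.symm (by omega) (by omega) hpx, [], ?_⟩
    rcases k with _ | k
    · exact ⟨List.replicate q a, by simp [run5, tameWord]⟩
    · exact ⟨List.replicate (x + 1) a ++ tameWord a b 0 (x + 1) k q, by
        simp [run5, tameWord, List.replicate_succ (n := k), List.replicate_succ (n := k + 1)]⟩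

theorem tame_or_exists_critical_infix (w : List (Fin 2)) :
    Tame w ∨ ∃ f, Critical f ∧ f <:+: w := by
  induction w with
  | nil => exact .inl (.inl rfl)
  | cons c w ih =>
    rcases ih with (rfl | ⟨a, b, p, x, k, q, hab, rfl⟩) | ⟨f, hf, hw⟩
    · exact .inl (tame_replicate (a := c) (b := c + 1) (by revert c; decide) 1)
    -- The binary alphabet is essential here: the new letter is one of the two already present.
    · obtain rfl | rfl : c = a ∨ c = b := by omega
      · exact .inl (.inr ⟨c, b, p + 1, x, k, q, hab, by simp [tameWord, List.replicate_succ]⟩)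
      · exact tame_or_exists_critical_infix_cons_tameWord hab p x k q
    · exact .inr ⟨f, hf, List.infix_cons hw⟩

theorem isMinimalNonPalindromePair_iff_critical (w : List (Fin 2)) :
    IsMinimalNonPalindromePair w ↔ Critical w := by
  refine ⟨fun h => ?_, Critical.isMinimalNonPalindromePair⟩
  rcases tame_or_exists_critical_infix w with hw | ⟨f, hf, hfw⟩
  · exact absurd hw.isPalindromePair h.1
  · by_cases hne : f = w
    · exact hne ▸ hf
    · exact absurd (h.2 f hfw hne) hf.not_isPalindromePair

/-! ### Blocks of words given by run lengths -/

theorem IsBlock.reverse {w x y : List α} {a : α} {n : ℕ} (h : IsBlock w x a n y) :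
    IsBlock w.reverse y.reverse a n x.reverse := by
  obtain ⟨rfl, hn, hx, hy⟩ := h
  exact ⟨by simp, hn, by simpa using hy, by simpa using hx⟩

theorem IsInternalMaximumBlock.reverse {w x y : List α} {a : α} {n : ℕ}
    (h : IsInternalMaximumBlock w x a n y) :
    IsInternalMaximumBlock w.reverse y.reverse a n x.reverse := by
  obtain ⟨h1, hx, hy, hmax⟩ := h
  refine ⟨h1.reverse, by simpa using hy, by simpa using hx, fun x' b m y' h' => ?_⟩
  exact hmax _ b m _ (by simpa using h'.reverse)

theorem ExtendsInternalMaximumBlock.reverse {w w' : List α}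
    (h : ExtendsInternalMaximumBlock w w') :
    ExtendsInternalMaximumBlock w.reverse w'.reverse := by
  obtain ⟨x, a, n, y, h, rfl⟩ := h
  exact ⟨_, a, n, _, h.reverse, by simp⟩

theorem ExtendsInternalMaximumBlock.length_eq {w w' : List α}
    (h : ExtendsInternalMaximumBlock w w') : w'.length = w.length + 1 := by
  obtain ⟨x, a, n, y, ⟨⟨rfl, -⟩, -⟩, rfl⟩ := h
  simp; omega

theorem not_isBlock_nil {x y : List α} {a : α} {n : ℕ} : ¬ IsBlock [] x a n y := by
  rintro ⟨h, hn, -⟩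
  have := congrArg List.length h
  simp at this; omega

theorem replicate_append_inj {c : α} {n m : ℕ} {y z : List α} (hy : y.head? ≠ some c)
    (hz : z.head? ≠ some c) (h : List.replicate n c ++ y = List.replicate m c ++ z) :
    n = m ∧ y = z := by
  induction n generalizing m with
  | zero =>
    cases m with
    | zero => simpa using h
    | succ m => simp at h; simp [h, List.replicate_succ] at hy
  | succ n ih =>
    cases m with
    | zero => simp at h; simp [← h, List.replicate_succ] at hz
    | succ m => simpa using ih (by simpa [List.replicate_succ] using h)

/-- A block of a word is its first block or a block of the remaining word. -/
theorem IsBlock.of_replicate_append {d : α} {m : ℕ} {z x y : List α} {c : α} {n : ℕ}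
    (hz : z.head? ≠ some d) (h : IsBlock (List.replicate m d ++ z) x c n y) :
    (x = [] ∧ c = d ∧ n = m ∧ y = z) ∨
      ∃ x', x = List.replicate m d ++ x' ∧ IsBlock z x' c n y := by
  obtain ⟨h, hn, hx, hy⟩ := h
  rw [List.append_assoc, List.append_eq_append_iff] at h
  have key : ∀ t, x = List.replicate m d ++ t → z = t ++ (List.replicate n c ++ y) →
      ∃ x', x = List.replicate m d ++ x' ∧ IsBlock z x' c n y := by
    rintro t rfl rfl
    refine ⟨t, rfl, by simp, hn, fun ht => hx ?_, hy⟩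
    simp [List.getLast?_append, ht]
  rcases h with ⟨t, rfl, ht⟩ | ⟨t, hxt, ht⟩
  · exact .inr (key t rfl ht)
  · rcases t with _ | ⟨e, t⟩
    · exact .inr (key [] (by simpa using hxt.symm) (by simpa using ht.symm))
    · obtain ⟨n, rfl⟩ := Nat.exists_eq_add_of_le' hn
      have hall : ∀ u ∈ x ++ e :: t, u = d := fun u hu => by
        rw [← hxt] at hu; exact List.eq_of_mem_replicate hu
      have hec : c = e := by simpa [List.replicate_succ] using congrArg List.head? ht
      have hcd : c = d := hec ▸ hall e (by simp)
      have hx0 : x = [] := by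
        by_contra hne
        apply hx
        rw [List.getLast?_eq_some_getLast hne, hcd,
          hall _ (List.mem_append_left _ (List.getLast_mem hne))]
      subst hx0 hcd
      rw [List.nil_append] at hxt
      rw [← hxt] at ht
      obtain ⟨h1, h2⟩ := replicate_append_inj hy hz ht
      exact .inl ⟨rfl, rfl, h1, h2⟩

theorem head?_replicate_append_ne {a b : α} (hab : a ≠ b) {n : ℕ} (hn : 1 ≤ n) (z : List α) :
    (List.replicate n b ++ z).head? ≠ some a := by
  obtain ⟨n, rfl⟩ := Nat.exists_eq_add_of_le' hn
  simpa [List.replicate_succ] using hab.symm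

theorem IsBlock.of_replicate {d : α} {m : ℕ} {x y : List α} {c : α} {n : ℕ}
    (h : IsBlock (List.replicate m d) x c n y) : n = m ∧ y = [] := by
  rw [← List.append_nil (List.replicate m d)] at h
  rcases h.of_replicate_append (by simp) with h | ⟨x', -, h⟩
  · exact ⟨h.2.2.1, h.2.2.2⟩
  · exact absurd h not_isBlock_nil

theorem IsBlock.of_run4 {a b : α} (hab : a ≠ b) {n₁ n₂ n₃ n₄ : ℕ} (h₂ : 1 ≤ n₂)
    (h₃ : 1 ≤ n₃) (h₄ : 1 ≤ n₄) {x y : List α} {c : α} {n : ℕ}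
    (h : IsBlock (run4 a b n₁ n₂ n₃ n₄) x c n y) :
    (n = n₁ ∧ x = []) ∨
    (n = n₂ ∧ x ++ List.replicate (n + 1) c ++ y = run4 a b n₁ (n₂ + 1) n₃ n₄) ∨
    (n = n₃ ∧ x ++ List.replicate (n + 1) c ++ y = run4 a b n₁ n₂ (n₃ + 1) n₄) ∨
    (n = n₄ ∧ y = []) := by
  have h₄' := head?_replicate_append_ne hab h₄ []
  rw [List.append_nil] at h₄'
  rcases h.of_replicate_append (head?_replicate_append_ne hab h₂ _) with
    ⟨rfl, rfl, rfl, rfl⟩ | ⟨x, rfl, hx₁⟩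
  · simp
  rcases hx₁.of_replicate_append (head?_replicate_append_ne hab.symm h₃ _) with
    ⟨rfl, rfl, rfl, rfl⟩ | ⟨x, rfl, hx₂⟩
  · simp [run4]
  rcases hx₂.of_replicate_append h₄' with ⟨rfl, rfl, rfl, rfl⟩ | ⟨x, rfl, hx₃⟩
  · simp [run4]
  exact .inr (.inr (.inr hx₃.of_replicate))

theorem IsBlock.of_run5 {a b : α} (hab : a ≠ b) {n₁ n₂ n₃ n₄ n₅ : ℕ} (h₂ : 1 ≤ n₂)
    (h₃ : 1 ≤ n₃) (h₄ : 1 ≤ n₄) (h₅ : 1 ≤ n₅) {x y : List α} {c : α} {n : ℕ}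
    (h : IsBlock (run5 a b n₁ n₂ n₃ n₄ n₅) x c n y) :
    (n = n₁ ∧ x = []) ∨
    (n = n₂ ∧ x ++ List.replicate (n + 1) c ++ y = run5 a b n₁ (n₂ + 1) n₃ n₄ n₅) ∨
    (n = n₃ ∧ x ++ List.replicate (n + 1) c ++ y = run5 a b n₁ n₂ (n₃ + 1) n₄ n₅) ∨
    (n = n₄ ∧ x ++ List.replicate (n + 1) c ++ y = run5 a b n₁ n₂ n₃ (n₄ + 1) n₅) ∨
    (n = n₅ ∧ y = []) := by
  have h₅' := head?_replicate_append_ne hab.symm h₅ []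
  rw [List.append_nil] at h₅'
  rcases h.of_replicate_append (head?_replicate_append_ne hab h₂ _) with
    ⟨rfl, rfl, rfl, rfl⟩ | ⟨x, rfl, hx₁⟩
  · simp
  rcases hx₁.of_replicate_append (head?_replicate_append_ne hab.symm h₃ _) with
    ⟨rfl, rfl, rfl, rfl⟩ | ⟨x, rfl, hx₂⟩
  · simp [run5]
  rcases hx₂.of_replicate_append (head?_replicate_append_ne hab h₄ _) with
    ⟨rfl, rfl, rfl, rfl⟩ | ⟨x, rfl, hx₃⟩
  · simp [run5]
  rcases hx₃.of_replicate_append h₅' with ⟨rfl, rfl, rfl, rfl⟩ | ⟨x, rfl, hx₄⟩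
  · simp [run5]
  exact .inr (.inr (.inr (.inr hx₄.of_replicate)))

theorem isBlock_append {x y : List α} {a : α} {n : ℕ} (hn : 1 ≤ n) (hx : x.getLast? ≠ some a)
    (hy : y.head? ≠ some a) : IsBlock (x ++ (List.replicate n a ++ y)) x a n y :=
  ⟨by simp, hn, hx, hy⟩

theorem getLast?_append_replicate_ne {a b : α} (hab : a ≠ b) {n : ℕ} (hn : 1 ≤ n)
    (z : List α) : (z ++ List.replicate n b).getLast? ≠ some a := by
  obtain ⟨n, rfl⟩ := Nat.exists_eq_add_of_le' hn
  simpa [List.replicate_succ', ← List.append_assoc] using hab.symm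

theorem extendsInternalMaximumBlock_run4_left {a b : α} (hab : a ≠ b) {n₁ n₂ n₃ n₄ : ℕ}
    (h₁ : 1 ≤ n₁) (h₂ : 1 ≤ n₂) (h₃ : 1 ≤ n₃) (h₄ : 1 ≤ n₄) (h₁₂ : n₁ ≤ n₂) (h₃₂ : n₃ ≤ n₂)
    (h₄₂ : n₄ ≤ n₂) :
    ExtendsInternalMaximumBlock (run4 a b n₁ n₂ n₃ n₄) (run4 a b n₁ (n₂ + 1) n₃ n₄) := by
  refine ⟨List.replicate n₁ a, b, n₂, List.replicate n₃ a ++ List.replicate n₄ b,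
    ⟨isBlock_append h₂ ?_ (head?_replicate_append_ne hab.symm h₃ _), ?_, ?_,
      fun x' c m y' h => ?_⟩, by simp [run4]⟩
  · simpa using getLast?_append_replicate_ne hab.symm h₁ []
  · simp; omega
  · simp; omega
  · rcases h.of_run4 hab h₂ h₃ h₄ with h | h | h | h <;> omega

theorem extendsInternalMaximumBlock_run5_left {a b : α} (hab : a ≠ b) {n₁ n₂ n₃ n₄ n₅ : ℕ}
    (h₁ : 1 ≤ n₁) (h₂ : 1 ≤ n₂) (h₃ : 1 ≤ n₃) (h₄ : 1 ≤ n₄) (h₅ : 1 ≤ n₅) (h₁₂ : n₁ ≤ n₂)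
    (h₃₂ : n₃ ≤ n₂) (h₄₂ : n₄ ≤ n₂) (h₅₂ : n₅ ≤ n₂) :
    ExtendsInternalMaximumBlock (run5 a b n₁ n₂ n₃ n₄ n₅)
      (run5 a b n₁ (n₂ + 1) n₃ n₄ n₅) := by
  refine ⟨List.replicate n₁ a, b, n₂,
    List.replicate n₃ a ++ (List.replicate n₄ b ++ List.replicate n₅ a),
    ⟨isBlock_append h₂ ?_ (head?_replicate_append_ne hab.symm h₃ _), ?_, ?_,
      fun x' c m y' h => ?_⟩, by simp [run5]⟩
  · simpa using getLast?_append_replicate_ne hab.symm h₁ []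
  · simp; omega
  · simp; omega
  · rcases h.of_run5 hab h₂ h₃ h₄ h₅ with h | h | h | h | h <;> omega

theorem ExtendsInternalMaximumBlock.of_run4 {a b : α} (hab : a ≠ b) {n₁ n₂ n₃ n₄ : ℕ}
    (h₁ : 1 ≤ n₁) (h₂ : 1 ≤ n₂) (h₃ : 1 ≤ n₃) (h₄ : 1 ≤ n₄) {w' : List α}
    (h : ExtendsInternalMaximumBlock (run4 a b n₁ n₂ n₃ n₄) w') :
    (n₁ ≤ n₂ ∧ n₃ ≤ n₂ ∧ n₄ ≤ n₂ ∧ w' = run4 a b n₁ (n₂ + 1) n₃ n₄) ∨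
    (n₁ ≤ n₃ ∧ n₂ ≤ n₃ ∧ n₄ ≤ n₃ ∧ w' = run4 a b n₁ n₂ (n₃ + 1) n₄) := by
  obtain ⟨x, c, n, y, ⟨hb, hx, hy, hmax⟩, rfl⟩ := h
  have e₁ := hmax [] a n₁ _ ⟨rfl, h₁, by simp, head?_replicate_append_ne hab h₂ _⟩
  have e₂ := hmax _ b n₂ _ (isBlock_append h₂
    (by simpa using getLast?_append_replicate_ne hab.symm h₁ [])
    (head?_replicate_append_ne hab.symm h₃ _))
  have e₃ := hmax (List.replicate n₁ a ++ List.replicate n₂ b) a n₃ (List.replicate n₄ b)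
    ⟨by simp [run4], h₃, getLast?_append_replicate_ne hab h₂ _,
      by simpa using head?_replicate_append_ne hab h₄ []⟩
  have e₄ := hmax (List.replicate n₁ a ++ List.replicate n₂ b ++ List.replicate n₃ a) b n₄ []
    ⟨by simp [run4], h₄, getLast?_append_replicate_ne hab.symm h₃ _, by simp⟩
  rcases hb.of_run4 hab h₂ h₃ h₄ with h | ⟨rfl, h⟩ | ⟨rfl, h⟩ | h
  · exact absurd h.2 hx
  · exact .inl ⟨e₁, e₃, e₄, h⟩
  · exact .inr ⟨e₁, e₂, e₄, h⟩
  · exact absurd h.2 hy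

theorem ExtendsInternalMaximumBlock.of_run5 {a b : α} (hab : a ≠ b) {n₁ n₂ n₃ n₄ n₅ : ℕ}
    (h₁ : 1 ≤ n₁) (h₂ : 1 ≤ n₂) (h₃ : 1 ≤ n₃) (h₄ : 1 ≤ n₄) (h₅ : 1 ≤ n₅) {w' : List α}
    (h : ExtendsInternalMaximumBlock (run5 a b n₁ n₂ n₃ n₄ n₅) w') :
    (n₄ ≤ n₂ ∧ w' = run5 a b n₁ (n₂ + 1) n₃ n₄ n₅) ∨
    (n₂ ≤ n₃ ∧ n₄ ≤ n₃ ∧ w' = run5 a b n₁ n₂ (n₃ + 1) n₄ n₅) ∨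
    (n₂ ≤ n₄ ∧ w' = run5 a b n₁ n₂ n₃ (n₄ + 1) n₅) := by
  obtain ⟨x, c, n, y, ⟨hb, hx, hy, hmax⟩, rfl⟩ := h
  have e₂ := hmax _ b n₂ _ (isBlock_append h₂
    (by simpa using getLast?_append_replicate_ne hab.symm h₁ [])
    (head?_replicate_append_ne hab.symm h₃ _))
  have e₄ := hmax (List.replicate n₁ a ++ List.replicate n₂ b ++ List.replicate n₃ a) b n₄
    (List.replicate n₅ a)
    ⟨by simp [run5], h₄, getLast?_append_replicate_ne hab.symm h₃ _,
      by simpa using head?_replicate_append_ne hab.symm h₅ []⟩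
  rcases hb.of_run5 hab h₂ h₃ h₄ h₅ with h | ⟨rfl, h⟩ | ⟨rfl, h⟩ | ⟨rfl, h⟩ | h
  · exact absurd h.2 hx
  · exact .inl ⟨e₄, h⟩
  · exact .inr (.inl ⟨e₂, e₄, h⟩)
  · exact .inr (.inr ⟨e₂, h⟩)
  · exact absurd h.2 hy

/-- The initial block `bb` forces a maximum block to have length at least two, while all internal
blocks of a zigzag are single letters. -/
theorem not_extendsInternalMaximumBlock_zigzag {a b : α} (hab : a ≠ b) {k : ℕ} (hk : 1 ≤ k)
    {w' : List α} : ¬ ExtendsInternalMaximumBlock (zigzag a b k) w' := by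
  rintro ⟨x, c, n, y, ⟨⟨hw, -⟩, hx, hy, hmax⟩, -⟩
  have hn : 2 ≤ n := by
    refine hmax [] b 2 ((List.replicate k [a, b]).flatten ++ [a, a])
      ⟨rfl, by omega, by simp, ?_⟩
    obtain ⟨k, rfl⟩ := Nat.exists_eq_add_of_le' hk
    simpa [List.replicate_succ] using hab
  have hlen := congrArg List.length hw
  rw [zigzag_length] at hlen
  simp only [List.length_append, List.length_replicate] at hlen
  have hx' := List.length_pos_of_ne_nil hx
  have hy' := List.length_pos_of_ne_nil hy
  have key : (zigzag a b k)[x.length]? = (zigzag a b k)[x.length + 1]? := by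
    rw [hw]
    simp only [List.getElem?_append, List.getElem?_replicate, List.length_append,
      List.length_replicate]
    split_ifs <;> first | rfl | omega
  rw [zigzag_getElem? _ _ _ _ (by omega), zigzag_getElem? _ _ _ _ (by omega),
    Option.some_inj] at key
  split_ifs at key
  all_goals first | omega | exact hab key | exact hab key.symm

/-- Maximality ensures that only a run of variable length can grow, and in the `unequal` case only
the longer one, so the two runs stay unequal. -/
theorem Critical.extends {w w' : List α} (hw : Critical w)
    (h : ExtendsInternalMaximumBlock w w') : Critical w' := by
  cases hw with
  | doubled a b n hab hn =>
    rcases h.of_run4 hab (by omega) (by omega) (by omega) (by omega) with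
      ⟨-, -, -, rfl⟩ | ⟨_, _, -⟩
    · exact .doubled a b _ hab (by omega)
    · omega
  | doubledReverse a b n hab hn =>
    rcases h.of_run4 hab (by omega) (by omega) (by omega) (by omega) with
      ⟨_, _, -⟩ | ⟨-, -, -, rfl⟩
    · omega
    · exact .doubledReverse a b _ hab (by omega)
  | adjacent a b p q hab hp hq =>
    rcases h.of_run4 hab (by omega) (by omega) (by omega) (by omega) with
      ⟨-, -, -, rfl⟩ | ⟨-, -, -, rfl⟩
    · exact .adjacent a b _ _ hab (by omega) (by omega)
    · exact .adjacent a b _ _ hab (by omega) (by omega)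
  | unequal a b p q hab hp hq hpq =>
    rcases h.of_run5 hab le_rfl hp le_rfl hq le_rfl with ⟨_, rfl⟩ | ⟨_, _, -⟩ | ⟨_, rfl⟩
    · exact .unequal a b _ _ hab (by omega) (by omega) (by omega)
    · omega
    · exact .unequal a b _ _ hab (by omega) (by omega) (by omega)
  | zigzag a b k hab hk => exact absurd h (not_extendsInternalMaximumBlock_zigzag hab hk)

/-! ### The inductive construction produces exactly the critical words -/

theorem critical_of_mem_lengthSixWords {w : List (Fin 2)} (h : w ∈ lengthSixWords) :
    Critical w ∧ w.length = 6 := by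
  have h01 : (0 : Fin 2) ≠ 1 := by decide
  have h10 : (1 : Fin 2) ≠ 0 := by decide
  simp only [lengthSixWords, List.mem_cons, List.not_mem_nil, or_false] at h
  rcases h with rfl | rfl | rfl | rfl | rfl | rfl | rfl | rfl | rfl | rfl | rfl | rfl
  · exact ⟨.zigzag 1 0 1 h10 le_rfl, rfl⟩
  · exact ⟨.doubled 0 1 2 h01 le_rfl, rfl⟩
  · exact ⟨.doubledReverse 0 1 2 h01 le_rfl, rfl⟩
  · exact ⟨.unequal 0 1 1 2 h01 le_rfl (by omega) (by omega), rfl⟩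
  · exact ⟨.adjacent 0 1 2 2 h01 le_rfl le_rfl, rfl⟩
  · exact ⟨.unequal 0 1 2 1 h01 (by omega) le_rfl (by omega), rfl⟩
  · exact ⟨.zigzag 0 1 1 h01 le_rfl, rfl⟩
  · exact ⟨.doubled 1 0 2 h10 le_rfl, rfl⟩
  · exact ⟨.doubledReverse 1 0 2 h10 le_rfl, rfl⟩
  · exact ⟨.unequal 1 0 1 2 h10 le_rfl (by omega) (by omega), rfl⟩
  · exact ⟨.adjacent 1 0 2 2 h10 le_rfl le_rfl, rfl⟩
  · exact ⟨.unequal 1 0 2 1 h10 (by omega) le_rfl (by omega), rfl⟩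

/-- Substituting `i = 2 * k + 4` removes the truncated divisions. -/
theorem addedWords_add_four (k : ℕ) :
    addedWords (2 * k + 4) = [zigzag 0 1 k, run5 0 1 1 k 1 (k + 1) 1, run5 1 0 1 k 1 (k + 1) 1,
      run4 0 1 1 (k + 1) (k + 1) 1] := by
  simp [addedWords, zigzag, run4, run5]

theorem critical_of_mem_addedWords {i : ℕ} (hi : 7 ≤ i) (hi' : Even i) {w : List (Fin 2)}
    (h : w ∈ addedWords i) : Critical w ∧ w.length = i := by
  obtain ⟨k, rfl⟩ : ∃ k, i = 2 * k + 4 := by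
    obtain ⟨j, rfl⟩ := hi'
    exact ⟨j - 2, by omega⟩
  rw [addedWords_add_four] at h
  simp only [List.mem_cons, List.not_mem_nil, or_false] at h
  rcases h with rfl | rfl | rfl | rfl
  · exact ⟨.zigzag 0 1 k (by decide) (by omega), zigzag_length ..⟩
  · exact ⟨.unequal 0 1 k (k + 1) (by decide) (by omega) (by omega) (by omega),
      by rw [run5_length]; omega⟩
  · exact ⟨.unequal 1 0 k (k + 1) (by decide) (by omega) (by omega) (by omega),
      by rw [run5_length]; omega⟩
  · exact ⟨.adjacent 0 1 (k + 1) (k + 1) (by decide) (by omega) (by omega),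
      by rw [run4_length]; omega⟩

theorem Constructed.critical {i : ℕ} {w : List (Fin 2)} (h : Constructed i w) :
    Critical w ∧ w.length = i := by
  induction h with
  | base w hw => exact critical_of_mem_lengthSixWords hw
  | extend i w w' hi _ hw ih => exact ⟨ih.1.extends hw, by rw [hw.length_eq, ih.2]; omega⟩
  | add i w hi hi' hw => exact critical_of_mem_addedWords hi hi' hw
  | addReverse i w hi hi' hw =>
    obtain ⟨h1, h2⟩ := critical_of_mem_addedWords hi hi' hw
    exact ⟨h1.reverse, by rw [List.length_reverse, h2]⟩

/-- Thanks to this symmetry only words whose left variable run is the longer one need to be built.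
-/
theorem Constructed.reverse {i : ℕ} {w : List (Fin 2)} (h : Constructed i w) :
    Constructed i w.reverse := by
  induction h with
  | base w hw =>
    refine .base _ ?_
    revert w
    decide
  | extend i w w' hi _ hw ih => exact .extend i _ _ hi ih hw.reverse
  | add i w hi hi' hw => exact .addReverse i w hi hi' hw
  | addReverse i w hi hi' hw => rw [List.reverse_reverse]; exact .add i w hi hi' hw

theorem constructed_run4_doubled {a b : Fin 2} (hab : a ≠ b) {n : ℕ} (hn : 2 ≤ n) :
    Constructed (n + 4) (run4 a b 2 n 1 1) := by
  induction n, hn using Nat.le_induction with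
  | base =>
    refine .base _ ?_
    revert a b
    decide
  | succ n hn ih =>
    exact .extend (n + 5) _ _ (by omega) ih (extendsInternalMaximumBlock_run4_left hab
      (by omega) (by omega) (by omega) (by omega) hn (by omega) (by omega))

theorem eq_zero_one_or_one_zero {a b : Fin 2} (hab : a ≠ b) :
    a = 0 ∧ b = 1 ∨ a = 1 ∧ b = 0 := by
  omega

theorem constructed_run4_diagonal {a b : Fin 2} (hab : a ≠ b) {q : ℕ} (hq : 2 ≤ q) :
    Constructed (2 * q + 2) (run4 a b 1 q q 1) := by
  obtain rfl | hq := hq.eq_or_lt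
  · refine .base _ ?_
    revert a b
    decide
  obtain ⟨k, rfl⟩ := Nat.exists_eq_add_of_le' (show 1 ≤ q by omega)
  have h : Constructed (2 * k + 4) (run4 0 1 1 (k + 1) (k + 1) 1) :=
    .add _ _ (by omega) ⟨k + 2, by omega⟩ (by rw [addedWords_add_four]; simp)
  rcases eq_zero_one_or_one_zero hab with ⟨rfl, rfl⟩ | ⟨rfl, rfl⟩
  · exact h
  -- Exchanging the two letters of this word amounts to reversing it, so one added word covers both
  -- choices.
  · have := h.reverse
    rwa [run4_reverse] at this

theorem constructed_run4_adjacent {a b : Fin 2} (hab : a ≠ b) {p q : ℕ} (hq : 2 ≤ q)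
    (hpq : q ≤ p) : Constructed (p + q + 2) (run4 a b 1 p q 1) := by
  induction p, hpq using Nat.le_induction with
  | base => rw [← two_mul]; exact constructed_run4_diagonal hab hq
  | succ p hpq ih =>
    refine .extend _ _ _ (by omega) ?_ (extendsInternalMaximumBlock_run4_left hab
      (by omega) (by omega) (by omega) (by omega) (by omega) hpq (by omega))
    rwa [show p + 1 + q + 2 - 1 = p + q + 2 by omega]

/-- For `q ≥ 2` these words must be added by hand: shortening the longer run would give the
palindrome `a b^q a b^q a`. The added words have the shorter run first, hence the reversal. -/
theorem constructed_run5_succ {a b : Fin 2} (hab : a ≠ b) {q : ℕ} (hq : 1 ≤ q) :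
    Constructed (2 * q + 4) (run5 a b 1 (q + 1) 1 q 1) := by
  obtain rfl | hq := hq.eq_or_lt
  · refine .base _ ?_
    revert a b
    decide
  rw [← run5_reverse]
  refine .addReverse _ _ (by omega) ⟨q + 2, by omega⟩ ?_
  rw [addedWords_add_four]
  rcases eq_zero_one_or_one_zero hab with ⟨rfl, rfl⟩ | ⟨rfl, rfl⟩ <;> simp

theorem constructed_run5 {a b : Fin 2} (hab : a ≠ b) {p q : ℕ} (hq : 1 ≤ q) (hpq : q < p) :
    Constructed (p + q + 3) (run5 a b 1 p 1 q 1) := by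
  induction p, hpq using Nat.le_induction with
  | base =>
    rw [show q + 1 + q + 3 = 2 * q + 4 by omega]
    exact constructed_run5_succ hab hq
  | succ p hpq ih =>
    refine .extend _ _ _ (by omega) ?_ (extendsInternalMaximumBlock_run5_left hab
      (by omega) (by omega) (by omega) (by omega) (by omega) (by omega) (by omega) (by omega)
      (by omega))
    rwa [show p + 1 + q + 3 - 1 = p + q + 3 by omega]

theorem constructed_zigzag {a b : Fin 2} (hab : a ≠ b) {k : ℕ} (hk : 1 ≤ k) :
    Constructed (2 * k + 4) (zigzag a b k) := by
  obtain rfl | hk := hk.eq_or_lt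
  · refine .base _ ?_
    revert a b
    decide
  have h : Constructed (2 * k + 4) (zigzag 0 1 k) :=
    .add _ _ (by omega) ⟨k + 2, by omega⟩ (by rw [addedWords_add_four]; simp)
  rcases eq_zero_one_or_one_zero hab with ⟨rfl, rfl⟩ | ⟨rfl, rfl⟩
  · exact h
  · simpa [zigzag_reverse] using h.reverse

theorem Critical.constructed {w : List (Fin 2)} (h : Critical w) : Constructed w.length w := by
  cases h with
  | doubled a b n hab hn =>
    rw [run4_length, show 2 + n + 1 + 1 = n + 4 by omega]
    exact constructed_run4_doubled hab hn
  | doubledReverse a b n hab hn =>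
    rw [run4_length, show 1 + 1 + n + 2 = n + 4 by omega, ← run4_reverse]
    exact (constructed_run4_doubled hab.symm hn).reverse
  | adjacent a b p q hab hp hq =>
    rw [run4_length]
    rcases le_total q p with h | h
    · rw [show 1 + p + q + 1 = p + q + 2 by omega]
      exact constructed_run4_adjacent hab hq h
    · rw [show 1 + p + q + 1 = q + p + 2 by omega, ← run4_reverse]
      exact (constructed_run4_adjacent hab.symm hp h).reverse
  | unequal a b p q hab hp hq hpq =>
    rw [run5_length]
    rcases hpq.lt_or_gt with h | h
    · rw [show 1 + p + 1 + q + 1 = q + p + 3 by omega, ← run5_reverse]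
      exact (constructed_run5 hab hp h).reverse
    · rw [show 1 + p + 1 + q + 1 = p + q + 3 by omega]
      exact constructed_run5 hab hq h
  | zigzag a b k hab hk => rw [zigzag_length]; exact constructed_zigzag hab hk

end PalindromePairs

theorem mainTheorem4 (i : ℕ) (w : List (Fin 2)) :
    (w.length = i ∧ PalindromePairs.IsMinimalNonPalindromePair w) ↔
      PalindromePairs.Constructed i w := by
  rw [PalindromePairs.isMinimalNonPalindromePair_iff_critical]
  constructor
  · rintro ⟨rfl, h⟩
    exact h.constructed
  · intro h
    exact h.critical.symm
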